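/- Let $h\ge 1$ be an integer and $R\ge 1$ a real number. The infinite grid with transmission range $R$ is the graph on $\mathbb{Z}^2$ in which two distinct nodes are adjacent iff their Euclidean distance is at most $R$. Two nodes are $k$-hop neighbours if their graph distance is $k$. An $h$-hop colouring assigns a colour to every node so that any two $k$-hop neighbours with $1\le k\le h$ receive different colours. Put $\rho=(R-\sqrt2)h$. For a set $S\subseteq\mathbb{Z}^2$ let $\overline d(S)=\limsup_{n\to\infty}|S\cap[-n,n]^2|/(2n+1)^2$ be its upper density. Theorem. (i) Any two nodes at Euclidean distance at most $\rho$ are at most $h$ hops apart. Moreover, for every $h$-hop colouring of the infinite grid with transmission range $R$: (ii) for each colour, the closed disks of radius $\rho/2$ centred at the nodes of that colour are pairwise disjoint (a disk of negative radius being empty); (iii) for each colour $a$, the set $S_a$ of nodes of colour $a$ satisfies $\overline d(S_a)\cdot\frac{\sqrt3}{2}h^2(R-\sqrt2)^2\le 1$; (iv) the number of colours used is at least $\frac{\sqrt3}{2}h^2(R-\sqrt2)^2$. -/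

import Mathlib

/-- The point of the Euclidean plane occupied by the grid node `p` (the grid step is the unit). -/
noncomputable def gridPoint (p : ℤ × ℤ) : EuclideanSpace ℝ (Fin 2) :=
  !₂[(p.1 : ℝ), (p.2 : ℝ)]

/-- The infinite grid with transmission range `R`: two distinct nodes are one-hop neighbours
iff their Euclidean distance is at most `R`. -/
noncomputable def gridGraph (R : ℝ) : SimpleGraph (ℤ × ℤ) where
  Adj u v := u ≠ v ∧ dist (gridPoint u) (gridPoint v) ≤ R
  symm := ⟨fun _ _ huv => ⟨huv.1.symm, by rw [dist_comm]; exact huv.2⟩⟩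
  loopless := ⟨fun _ hu => hu.1 rfl⟩

/-- `u` and `v` are `k`-hop neighbours: a shortest path between them has exactly `k` edges. -/
def IsHopNeighbor {V : Type*} (G : SimpleGraph V) (k : ℕ) (u v : V) : Prop :=
  G.edist u v = (k : ℕ∞)

/-- `c` is a (valid) `h`-hop node colouring of `G`: any two nodes that are `k`-hop neighbours
with `1 ≤ k ≤ h` have different colours. -/
def IsHopColoring {V C : Type*} (G : SimpleGraph V) (h : ℕ) (c : V → C) : Prop :=
  ∀ k : ℕ, 1 ≤ k → k ≤ h → ∀ u v : V, IsHopNeighbor G k u v → c u ≠ c v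

/-- The nodes of the grid in the square `[-n, n] × [-n, n]`; there are `(2n+1)²` of them. -/
def gridBox (n : ℕ) : Set (ℤ × ℤ) :=
  Set.Icc (-(n : ℤ)) n ×ˢ Set.Icc (-(n : ℤ)) n

/-- The upper (asymptotic) density of a set of grid nodes, that is, the `limsup` of the proportion
of the nodes of `[-n, n]²` that belong to it. The proportions lie in `[0, 1]`. -/
noncomputable def gridUpperDensity (S : Set (ℤ × ℤ)) : ℝ :=
  Filter.limsup (fun n : ℕ => ((S ∩ gridBox n).ncard : ℝ) / (2 * (n : ℝ) + 1) ^ 2) Filter.atTop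

/-! Cut the segment between two nodes into `h` equal steps and round the division points to nodes.
Rounding changes each step by a vector of length at most `√2`, so a step of length at most `R - √2`
becomes a hop of length at most `R`. This gives (i), and the triangle inequality then gives (ii).

Consequently a colour class is separated by `δ = |R - √2| * h`. The absolute value matters: for `R <
√2` the radius is negative but its square still enters (iii) and (iv), so this range has its own
argument (`edist_gridGraph_le_of_dist_le_abs`).

The rest is Thue's bound for `δ`-separated sets (`card_mul_le_of_separated`): Voronoi cells,
truncated to disks of radius `r = δ / √3`, are disjoint, and each has at least the area `√3 / 2 * δ
^ 2` of the regular hexagon inscribed in the disk. Indeed each neighbour cuts off a cap of the disk,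
the sectors spanned by these caps are disjoint, and a cap takes up at most the fraction
`hexagonDefect` of its sector. Counting in large boxes gives (iii); summing over the colours gives
(iv). -/

/-! ### Areas of sectors and caps of a disk. -/

open MeasureTheory Set in
theorem volume_eq_lintegral_polar {E : Set ℂ} (hE : MeasurableSet E) {θ : ℝ} (hθ : θ ≤ Real.pi)
    {g : ℝ → ℝ} (hg : ∀ φ ∈ Ioo (-θ) θ, 0 ≤ g φ)
    (h : ∀ t > (0 : ℝ), ∀ φ ∈ Ioo (-Real.pi) Real.pi,
      ((t : ℂ) * (Real.cos φ + Real.sin φ * Complex.I) ∈ E ↔ φ ∈ Ioo (-θ) θ ∧ t < g φ)) :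
    volume E = ∫⁻ φ in Ioo (-θ) θ, ENNReal.ofReal (g φ ^ 2 / 2) := by
  rw [← lintegral_indicator_one hE, ← Complex.lintegral_comp_polarCoord_symm]
  have hm : Measurable (fun p : ℝ × ℝ =>
      ENNReal.ofReal p.1 • E.indicator (1 : ℂ → ENNReal) (Complex.polarCoord.symm p)) := by
    refine (ENNReal.measurable_ofReal.comp measurable_fst).smul ?_
    refine (measurable_one.indicator hE).comp ?_
    simp_rw [funext Complex.polarCoord_symm_apply]
    fun_prop
  have htgt : polarCoord.target = Ioi (0 : ℝ) ×ˢ Ioo (-Real.pi) Real.pi := rfl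
  rw [htgt, Measure.volume_eq_prod, ← Measure.prod_restrict, lintegral_prod_symm _ hm.aemeasurable]
  have hsub : Ioo (-θ) θ ⊆ Ioo (-Real.pi) Real.pi := Ioo_subset_Ioo (by linarith) hθ
  have inner : ∀ φ ∈ Ioo (-Real.pi) Real.pi,
      (∫⁻ t in Ioi (0 : ℝ), ENNReal.ofReal t •
        E.indicator (1 : ℂ → ENNReal) (Complex.polarCoord.symm (t, φ))) =
      (Ioo (-θ) θ).indicator (fun φ => ENNReal.ofReal (g φ ^ 2 / 2)) φ := by
    intro φ hφ
    by_cases hφ' : φ ∈ Ioo (-θ) θ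
    · rw [indicator_of_mem hφ']
      have h1 : ∀ t ∈ Ioi (0 : ℝ), ENNReal.ofReal t •
          E.indicator (1 : ℂ → ENNReal) (Complex.polarCoord.symm (t, φ)) =
          (Iio (g φ)).indicator (fun t => ENNReal.ofReal t) t := by
        intro t ht
        have := h t ht φ hφ
        rw [Complex.polarCoord_symm_apply]
        by_cases htg : t < g φ
        · rw [indicator_of_mem (this.2 ⟨hφ', htg⟩), indicator_of_mem (by exact htg)]
          simp
        · rw [indicator_of_notMem (fun hh => htg (this.1 hh).2), indicator_of_notMem (by exact htg)]
          simp
      rw [setLIntegral_congr_fun measurableSet_Ioi h1, setLIntegral_indicator measurableSet_Iio,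
        inter_comm, Ioi_inter_Iio, restrict_Ioo_eq_restrict_Ioc,
        ← ofReal_integral_eq_lintegral_ofReal,
        ← intervalIntegral.integral_of_le (hg φ hφ'), integral_id]
      · simp
      · exact (continuous_id.integrableOn_Icc).mono_set Ioc_subset_Icc_self
      · filter_upwards [ae_restrict_mem measurableSet_Ioc] with t ht using ht.1.le
    · rw [indicator_of_notMem hφ']
      rw [setLIntegral_congr_fun (g := fun _ => 0) measurableSet_Ioi, lintegral_zero]
      intro t ht
      simp only
      rw [Complex.polarCoord_symm_apply, indicator_of_notMem, smul_zero]
      exact fun hh => hφ' ((h t ht φ hφ).1 hh).1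
  rw [setLIntegral_congr_fun measurableSet_Ioo inner, setLIntegral_indicator measurableSet_Ioo,
    inter_eq_self_of_subset_left hsub]

/-- The open sector of the disk of radius `r` about `0` that is spanned by the arc cut off by the
bisector of `0` and `y`. -/
def diskSector (r : ℝ) (y : ℂ) : Set ℂ :=
  {z | ‖z‖ < r ∧ ‖y‖ ^ 2 * ‖z‖ < 2 * r * (z * (starRingEnd ℂ) y).re}

/-- The cap cut off the disk of radius `r` about `0` by the bisector of `0` and `y`. -/
def diskCap (r : ℝ) (y : ℂ) : Set ℂ :=
  {z | ‖z‖ < r ∧ ‖y‖ ^ 2 ≤ 2 * (z * (starRingEnd ℂ) y).re}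

theorem measurableSet_diskSector (r : ℝ) (y : ℂ) : MeasurableSet (diskSector r y) := by
  have h1 : MeasurableSet {z : ℂ | ‖z‖ < r} := measurableSet_lt (by fun_prop) (by fun_prop)
  have h2 : MeasurableSet {z : ℂ | ‖y‖ ^ 2 * ‖z‖ < 2 * r * (z * (starRingEnd ℂ) y).re} :=
    measurableSet_lt (by fun_prop) (by fun_prop)
  exact h1.inter h2

theorem measurableSet_diskCap (r : ℝ) (y : ℂ) : MeasurableSet (diskCap r y) := by
  have h1 : MeasurableSet {z : ℂ | ‖z‖ < r} := measurableSet_lt (by fun_prop) (by fun_prop)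
  have h2 : MeasurableSet {z : ℂ | ‖y‖ ^ 2 ≤ 2 * (z * (starRingEnd ℂ) y).re} :=
    measurableSet_le (by fun_prop) (by fun_prop)
  exact h1.inter h2

theorem diskCap_subset_diskSector {r : ℝ} {y : ℂ} (hr : 0 < r) (hy : y ≠ 0) :
    diskCap r y ⊆ diskSector r y := by
  rintro z ⟨h1, h2⟩
  refine ⟨h1, ?_⟩
  have : 0 < ‖y‖ ^ 2 := by positivity
  nlinarith

theorem cos_lt_cos_iff_mem_Ioo {θ φ : ℝ} (h0 : 0 ≤ θ) (h1 : θ ≤ Real.pi)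
    (hφ : φ ∈ Set.Ioo (-Real.pi) Real.pi) :
    Real.cos θ < Real.cos φ ↔ φ ∈ Set.Ioo (-θ) θ := by
  rw [← Real.cos_abs φ, Real.strictAntiOn_cos.lt_iff_gt ⟨h0, h1⟩
    ⟨abs_nonneg _, (abs_lt.2 hφ).le⟩, abs_lt]
  rfl

theorem norm_mul_cos_add_sin {t φ : ℝ} (ht : 0 < t) :
    ‖(t : ℂ) * (Real.cos φ + Real.sin φ * Complex.I)‖ = t := by
  rw [norm_mul, Complex.norm_real, Real.norm_of_nonneg ht.le, Complex.ofReal_cos,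
    Complex.ofReal_sin, Complex.norm_cos_add_sin_mul_I, mul_one]

theorem re_mul_cos_add_sin (t φ s : ℝ) :
    ((t : ℂ) * (Real.cos φ + Real.sin φ * Complex.I) * (starRingEnd ℂ) (s : ℂ)).re
      = t * Real.cos φ * s := by
  rw [Complex.conj_ofReal, Complex.re_mul_ofReal, Complex.re_ofReal_mul,
    Complex.add_re, Complex.re_ofReal_mul, Complex.ofReal_re, Complex.I_re, mul_zero, add_zero]

theorem mem_diskSector_polar {r θ t φ : ℝ} (hr : 0 < r) (h0 : 0 < θ) (h1 : θ < Real.pi / 2)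
    (ht : 0 < t) (hφ : φ ∈ Set.Ioo (-Real.pi) Real.pi) :
    (t : ℂ) * (Real.cos φ + Real.sin φ * Complex.I) ∈ diskSector r ((2 * r * Real.cos θ : ℝ) : ℂ) ↔
      φ ∈ Set.Ioo (-θ) θ ∧ t < r := by
  have hc : 0 < Real.cos θ := Real.cos_pos_of_mem_Ioo ⟨by linarith, h1⟩
  rw [← cos_lt_cos_iff_mem_Ioo h0.le (by linarith [Real.pi_pos]) hφ, and_comm]
  simp only [diskSector, Set.mem_ofPred_eq]
  rw [norm_mul_cos_add_sin ht, re_mul_cos_add_sin, Complex.norm_real,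
    Real.norm_of_nonneg (by positivity)]
  refine and_congr_right fun _ => ?_
  have h2 : (2 * r * Real.cos θ) ^ 2 * t = (4 * r ^ 2 * Real.cos θ * t) * Real.cos θ := by ring
  have h3 : 2 * r * (t * Real.cos φ * (2 * r * Real.cos θ)) =
    (4 * r ^ 2 * Real.cos θ * t) * Real.cos φ := by ring
  rw [h2, h3, mul_lt_mul_iff_right₀ (by positivity)]

open MeasureTheory in
theorem volume_diskSector_ofReal {r θ : ℝ} (hr : 0 < r) (h0 : 0 < θ) (h1 : θ < Real.pi / 2) :
    volume (diskSector r ((2 * r * Real.cos θ : ℝ) : ℂ)) = ENNReal.ofReal (r ^ 2 * θ) := by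
  rw [volume_eq_lintegral_polar (measurableSet_diskSector _ _) (θ := θ) (g := fun _ => r)
    (by linarith [Real.pi_pos]) (fun _ _ => hr.le)
    (fun t ht φ hφ => mem_diskSector_polar hr h0 h1 ht hφ), setLIntegral_const, Real.volume_Ioo,
    ← ENNReal.ofReal_mul (by positivity)]
  congr 1
  ring

open MeasureTheory in
theorem volume_diskSector_diff_diskCap_ofReal {r θ : ℝ} (hr : 0 < r) (h0 : 0 < θ)
    (h1 : θ < Real.pi / 2) :
    volume (diskSector r ((2 * r * Real.cos θ : ℝ) : ℂ) \ diskCap r ((2 * r * Real.cos θ : ℝ) : ℂ))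
      = ENNReal.ofReal (r ^ 2 * (Real.sin θ * Real.cos θ)) := by
  have hc : 0 < Real.cos θ := Real.cos_pos_of_mem_Ioo ⟨by linarith, h1⟩
  have hcφ : ∀ φ ∈ Set.Icc (-θ) θ, 0 < Real.cos φ := fun φ hφ =>
    Real.cos_pos_of_mem_Ioo ⟨by linarith [hφ.1], by linarith [hφ.2]⟩
  -- The difference is an isosceles triangle with legs `r` and apex angle `2 * θ`; `g` is the polar
  -- equation of the bisector that carries its base.
  rw [volume_eq_lintegral_polar ((measurableSet_diskSector _ _).diff (measurableSet_diskCap _ _))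
    (θ := θ) (g := fun φ => r * Real.cos θ / Real.cos φ) (by linarith [Real.pi_pos])]
  · have hd : ∀ φ ∈ Set.uIcc (-θ) θ,
        HasDerivAt (fun φ => (r * Real.cos θ) ^ 2 / 2 * Real.tan φ)
          ((r * Real.cos θ / Real.cos φ) ^ 2 / 2) φ := by
      intro φ hφ
      rw [Set.uIcc_of_le (by linarith)] at hφ
      refine ((Real.hasDerivAt_tan (hcφ φ hφ).ne').const_mul
        ((r * Real.cos θ) ^ 2 / 2)).congr_deriv ?_
      ring
    have hcont : ContinuousOn (fun φ => (r * Real.cos θ / Real.cos φ) ^ 2 / 2)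
        (Set.Icc (-θ) θ) := by
      refine ContinuousOn.div_const (ContinuousOn.pow (ContinuousOn.div continuousOn_const
        Real.continuous_cos.continuousOn fun φ hφ => (hcφ φ hφ).ne') 2) 2
    rw [restrict_Ioo_eq_restrict_Ioc, ← ofReal_integral_eq_lintegral_ofReal,
      ← intervalIntegral.integral_of_le (by linarith),
      intervalIntegral.integral_eq_sub_of_hasDerivAt hd]
    · congr 1
      rw [Real.tan_neg, Real.tan_eq_sin_div_cos]
      field_simp
      ring
    · exact ContinuousOn.intervalIntegrable (by rwa [Set.uIcc_of_le (by linarith)])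
    · exact (hcont.integrableOn_Icc).mono_set Set.Ioc_subset_Icc_self
    · exact Filter.Eventually.of_forall fun φ => by positivity
  · exact fun φ hφ => div_nonneg (by positivity) (hcφ φ ⟨hφ.1.le, hφ.2.le⟩).le
  · intro t ht φ hφ
    rw [Set.mem_sdiff, mem_diskSector_polar hr h0 h1 ht hφ, and_assoc]
    refine and_congr_right fun hφ' => ?_
    have hcp := hcφ φ ⟨hφ'.1.le, hφ'.2.le⟩
    have hlt := (cos_lt_cos_iff_mem_Ioo h0.le (by linarith [Real.pi_pos]) hφ).2 hφ'
    simp only [diskCap, Set.mem_ofPred_eq]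
    rw [norm_mul_cos_add_sin ht, re_mul_cos_add_sin, Complex.norm_real,
      Real.norm_of_nonneg (by positivity), lt_div_iff₀ hcp]
    have h2 : (2 * r * Real.cos θ) ^ 2 = (4 * r * Real.cos θ) * (r * Real.cos θ) := by ring
    have h3 : 2 * (t * Real.cos φ * (2 * r * Real.cos θ)) =
      (4 * r * Real.cos θ) * (t * Real.cos φ) := by ring
    rw [h2, h3, mul_le_mul_iff_right₀ (by positivity)]
    constructor
    · rintro ⟨h4, h5⟩
      exact not_le.1 fun h6 => h5 ⟨h4, h6⟩
    · intro h4
      refine ⟨?_, fun h5 => absurd h5.2 (not_le.2 h4)⟩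
      by_contra! h5
      nlinarith

/-- The proportion of a disk that lies outside its inscribed regular hexagon. -/
noncomputable def hexagonDefect : ℝ := 1 - 3 * √3 / (2 * Real.pi)

/-- By concavity, `sin (2 * θ)` lies above its chord over `[0, π / 3]`. The constant is the
triangle-to-sector area ratio at `θ = π / 6`, the hexagonal case. -/
theorem mul_le_sin_mul_cos {θ : ℝ} (h0 : 0 < θ) (h1 : θ ≤ Real.pi / 6) :
    3 * √3 / (2 * Real.pi) * θ ≤ Real.sin θ * Real.cos θ := by
  have hpi := Real.pi_pos
  have hx : (0 : ℝ) ∈ Set.Icc 0 Real.pi := ⟨le_rfl, hpi.le⟩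
  have hy : Real.pi / 3 ∈ Set.Icc 0 Real.pi := ⟨by positivity, by linarith⟩
  have ha : 0 ≤ 1 - 6 * θ / Real.pi := by
    rw [sub_nonneg, div_le_one hpi]
    linarith
  have h := strictConcaveOn_sin_Icc.concaveOn.2 hx hy ha
    (show 0 ≤ 6 * θ / Real.pi by positivity) (by ring)
  simp only [smul_eq_mul, Real.sin_zero, mul_zero, zero_add, Real.sin_pi_div_three] at h
  have h2 : 6 * θ / Real.pi * (Real.pi / 3) = 2 * θ := by field_simp; ring
  rw [h2, Real.sin_two_mul] at h
  have h3 : 3 * √3 / (2 * Real.pi) * θ = (6 * θ / Real.pi * (√3 / 2)) / 2 := by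
    field_simp
    ring
  linarith

theorem hexagonDefect_nonneg : 0 ≤ hexagonDefect := by
  have h := mul_le_sin_mul_cos (θ := Real.pi / 6) (by positivity) le_rfl
  have h2 := (Real.sin_lt (x := Real.pi / 6) (by positivity)).le
  have h3 := Real.cos_le_one (Real.pi / 6)
  have h4 : Real.sin (Real.pi / 6) * Real.cos (Real.pi / 6) ≤ Real.pi / 6 := by
    have : 0 ≤ Real.sin (Real.pi / 6) := by rw [Real.sin_pi_div_six]; norm_num
    nlinarith
  have h5 := le_of_mul_le_mul_right (a := Real.pi / 6) (h.trans (h4.trans (one_mul _).ge))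
    (by positivity)
  unfold hexagonDefect
  linarith

open MeasureTheory in
theorem volume_diskCap_ofReal_le {r s : ℝ} (hr : 0 < r) (hs : √3 * r ≤ s) :
    volume (diskCap r (s : ℂ)) ≤ ENNReal.ofReal hexagonDefect * volume (diskSector r (s : ℂ)) := by
  have hs0 : 0 < s := lt_of_lt_of_le (by positivity) hs
  rcases le_or_gt (2 * r) s with h2 | h2
  -- The bisector does not meet the open disk.
  · have : diskCap r (s : ℂ) = ∅ := by
      refine Set.eq_empty_of_forall_notMem fun z hz => ?_
      obtain ⟨h3, h4⟩ := hz
      rw [Complex.conj_ofReal, Complex.re_mul_ofReal, Complex.norm_real,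
        Real.norm_of_nonneg hs0.le] at h4
      have := Complex.re_le_norm z
      nlinarith
    rw [this]
    simp
  -- Half the angle of the sector; `√3 * r ≤ s` says exactly that it is at most `π / 6`.
  · set θ := Real.arccos (s / (2 * r)) with hθ
    have hx : s / (2 * r) < 1 := by rw [div_lt_one (by positivity)]; exact h2
    have hx0 : 0 < s / (2 * r) := by positivity
    have h0 : 0 < θ := Real.arccos_pos.2 hx
    have h6 : θ ≤ Real.pi / 6 := by
      have h7 : Real.pi / 6 = Real.arccos (√3 / 2) := by
        rw [← Real.cos_pi_div_six, Real.arccos_cos] <;> linarith [Real.pi_pos]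
      rw [h7]
      refine Real.arccos_le_arccos ?_
      rw [div_le_div_iff₀ (by norm_num) (by positivity)]
      linarith
    have hpi := Real.pi_pos
    have hsθ : s = 2 * r * Real.cos θ := by
      rw [hθ, Real.cos_arccos (by linarith) hx.le]
      field_simp
    rw [hsθ]
    have hA := volume_diskSector_ofReal hr h0 (by linarith)
    have hB := volume_diskSector_diff_diskCap_ofReal hr h0 (by linarith)
    have hsub := diskCap_subset_diskSector (r := r) (y := ((2 * r * Real.cos θ : ℝ) : ℂ)) hr (by
      rw [← hsθ]; exact_mod_cast hs0.ne')
    have hadd := measure_sdiff_add_inter (μ := volume)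
      (diskSector r ((2 * r * Real.cos θ : ℝ) : ℂ)) (measurableSet_diskCap r
      ((2 * r * Real.cos θ : ℝ) : ℂ))
    rw [Set.inter_eq_self_of_subset_right hsub, hA, hB, add_comm] at hadd
    have := ENNReal.eq_sub_of_add_eq ENNReal.ofReal_ne_top hadd
    have hsc := mul_le_sin_mul_cos h0 h6
    rw [this, hA, ← ENNReal.ofReal_sub _ (by
        have : 0 ≤ 3 * √3 / (2 * Real.pi) * θ := by positivity
        have := this.trans hsc
        positivity), ← ENNReal.ofReal_mul hexagonDefect_nonneg]
    refine ENNReal.ofReal_le_ofReal ?_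
    unfold hexagonDefect
    nlinarith [mul_le_mul_of_nonneg_left hsc (sq_nonneg r)]

theorem exists_circle_mul_norm (y : ℂ) : ∃ u : Circle, y = u * (‖y‖ : ℂ) := by
  refine ⟨Circle.exp (Complex.arg y), ?_⟩
  rw [Circle.coe_exp, mul_comm, Complex.norm_mul_exp_arg_mul_I]

theorem re_circle_mul_conj (u : Circle) (w v : ℂ) :
    (((u : ℂ) * w) * (starRingEnd ℂ) (u * v)).re = (w * (starRingEnd ℂ) v).re := by
  have h : (u : ℂ) * (starRingEnd ℂ) (u : ℂ) = 1 := by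
    rw [Complex.mul_conj, Circle.normSq_coe, Complex.ofReal_one]
  rw [map_mul]
  congr 1
  linear_combination (w * (starRingEnd ℂ) v) * h

open MeasureTheory in
theorem volume_diskCap_circle_mul (u : Circle) (r : ℝ) (v : ℂ) :
    volume (diskCap r (u * v)) = volume (diskCap r v) := by
  rw [← (rotation u).measurePreserving.measure_preimage
    (measurableSet_diskCap r (u * v)).nullMeasurableSet]
  congr 1
  ext w
  simp only [diskCap, Set.mem_preimage, Set.mem_ofPred_eq, rotation_apply, re_circle_mul_conj,
    norm_mul, Circle.norm_coe, one_mul]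

open MeasureTheory in
theorem volume_diskSector_circle_mul (u : Circle) (r : ℝ) (v : ℂ) :
    volume (diskSector r (u * v)) = volume (diskSector r v) := by
  rw [← (rotation u).measurePreserving.measure_preimage
    (measurableSet_diskSector r (u * v)).nullMeasurableSet]
  congr 1
  ext w
  simp only [diskSector, Set.mem_preimage, Set.mem_ofPred_eq, rotation_apply, re_circle_mul_conj,
    norm_mul, Circle.norm_coe, one_mul]

open MeasureTheory in
theorem volume_diskCap_le {r : ℝ} {y : ℂ} (hr : 0 < r) (hy : √3 * r ≤ ‖y‖) :
    volume (diskCap r y) ≤ ENNReal.ofReal hexagonDefect * volume (diskSector r y) := by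
  obtain ⟨u, hu⟩ := exists_circle_mul_norm y
  rw [hu, volume_diskCap_circle_mul, volume_diskSector_circle_mul]
  exact volume_diskCap_ofReal_le hr hy

/-- If `z` were in both sectors, then `p = r * z / ‖z‖` would be at distance `r` from `0` and less
than `r` from `y` and `y'`. By Leibniz's identity for the centroid, the squared sides of the
triangle `0, y, y'` would then sum to less than `9 * r ^ 2`, whereas each is at least `3 * r ^ 2`.
-/
theorem disjoint_diskSector {r : ℝ} {y y' : ℂ} (hr : 0 < r) (hy : √3 * r ≤ ‖y‖)
    (hy' : √3 * r ≤ ‖y'‖) (hyy : √3 * r ≤ ‖y - y'‖) :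
    Disjoint (diskSector r y) (diskSector r y') := by
  rw [Set.disjoint_left]
  rintro z ⟨-, h1⟩ ⟨-, h2⟩
  have hz : z ≠ 0 := by
    rintro rfl
    simp at h1
  have hz0 : 0 < ‖z‖ := norm_pos_iff.2 hz
  have h3 : √3 ^ 2 = 3 := Real.sq_sqrt (by norm_num)
  have hsq : ∀ v : ℂ, √3 * r ≤ ‖v‖ → 3 * r ^ 2 ≤ v.re * v.re + v.im * v.im := by
    intro v hv
    have := pow_le_pow_left₀ (by positivity) hv 2
    rwa [mul_pow, h3, ← Complex.normSq_eq_norm_sq, Complex.normSq_apply] at this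
  have e1 := hsq y hy
  have e2 := hsq y' hy'
  have e3 := hsq (y - y') hyy
  rw [← Complex.normSq_eq_norm_sq, Complex.normSq_apply] at h1 h2
  simp only [Complex.mul_re, Complex.conj_re, Complex.conj_im, Complex.sub_re, Complex.sub_im]
    at h1 h2 e3
  set a := r * z.re / ‖z‖ with ha
  set b := r * z.im / ‖z‖ with hb
  have hzz : z.re * z.re + z.im * z.im = ‖z‖ ^ 2 := by
    rw [← Complex.normSq_eq_norm_sq, Complex.normSq_apply]
  have hab : a * a + b * b = r ^ 2 := by
    rw [ha, hb]
    field_simp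
    linear_combination hzz
  have f1 : y.re * y.re + y.im * y.im < 2 * (a * y.re + b * y.im) := by
    rw [← mul_lt_mul_iff_left₀ hz0]
    refine h1.trans_eq ?_
    rw [ha, hb]
    field_simp
    ring
  have f2 : y'.re * y'.re + y'.im * y'.im < 2 * (a * y'.re + b * y'.im) := by
    rw [← mul_lt_mul_iff_left₀ hz0]
    refine h2.trans_eq ?_
    rw [ha, hb]
    field_simp
    ring
  -- The two squares add up to `9` times the squared distance from `(a, b)` to the centroid.
  nlinarith [sq_nonneg (y.re + y'.re - 3 * a), sq_nonneg (y.im + y'.im - 3 * b)]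

/-! ### Truncated Voronoi cells and Thue's bound. -/

/-- The open Voronoi cell of `0` with respect to `Y`, truncated to the disk of radius `r`. -/
def truncatedCell (r : ℝ) (Y : Set ℂ) : Set ℂ :=
  {z | ‖z‖ < r ∧ ∀ y ∈ Y, ‖z‖ < ‖z - y‖}

open MeasureTheory in
-- The disk is covered by the cell and the caps. As the sectors are disjoint parts of the disk, the
-- caps together have at most `hexagonDefect` of its area, which leaves the area of the inscribed
-- hexagon.
theorem le_volume_truncatedCell {r : ℝ} {Y : Set ℂ} (hr : 0 < r) (hY : Y.Countable)
    (h0 : ∀ y ∈ Y, √3 * r ≤ ‖y‖) (hsep : Y.Pairwise fun y y' => √3 * r ≤ ‖y - y'‖) :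
    ENNReal.ofReal (3 * √3 / 2 * r ^ 2) ≤ volume (truncatedCell r Y) := by
  have hcov : Metric.ball (0 : ℂ) r ⊆ truncatedCell r Y ∪ ⋃ y ∈ Y, diskCap r y := by
    intro z hz
    rw [mem_ball_zero_iff] at hz
    by_cases h : ∀ y ∈ Y, ‖z‖ < ‖z - y‖
    · exact Or.inl ⟨hz, h⟩
    · push Not at h
      obtain ⟨y, hy, h⟩ := h
      refine Or.inr (Set.mem_biUnion hy ⟨hz, ?_⟩)
      have h2 := pow_le_pow_left₀ (norm_nonneg _) h 2
      simp only [← Complex.normSq_eq_norm_sq, Complex.normSq_apply, Complex.mul_re,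
        Complex.conj_re, Complex.conj_im, Complex.sub_re, Complex.sub_im] at h2 ⊢
      linarith
  have hcaps : volume (⋃ y ∈ Y, diskCap r y) ≤
      ENNReal.ofReal hexagonDefect * volume (Metric.ball (0 : ℂ) r) := by
    have hdisj : Y.PairwiseDisjoint (diskSector r) := fun y hy y' hy' hne =>
      disjoint_diskSector hr (h0 y hy) (h0 y' hy') (hsep hy hy' hne)
    calc volume (⋃ y ∈ Y, diskCap r y) ≤ ∑' y : Y, volume (diskCap r (y : ℂ)) :=
          measure_biUnion_le volume hY _
      _ ≤ ∑' y : Y, ENNReal.ofReal hexagonDefect * volume (diskSector r (y : ℂ)) :=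
          ENNReal.tsum_le_tsum fun y => volume_diskCap_le hr (h0 y y.2)
      _ = ENNReal.ofReal hexagonDefect * volume (⋃ y ∈ Y, diskSector r y) := by
          rw [ENNReal.tsum_mul_left, measure_biUnion hY hdisj fun y _ =>
            measurableSet_diskSector r y]
      _ ≤ _ := by
          gcongr
          refine Set.iUnion₂_subset fun y _ z hz => ?_
          rw [mem_ball_zero_iff]
          exact hz.1
  have hball : volume (Metric.ball (0 : ℂ) r) = ENNReal.ofReal (Real.pi * r ^ 2) := by
    rw [Complex.volume_ball, mul_comm, ENNReal.ofReal_mul Real.pi_pos.le,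
      ENNReal.ofReal_pow hr.le]
    congr 1
    rw [← NNReal.coe_real_pi, ENNReal.ofReal_coe_nnreal]
  have h1 := (measure_mono hcov).trans ((measure_union_le _ _).trans (add_le_add_right hcaps _))
  rw [hball, ← ENNReal.ofReal_mul hexagonDefect_nonneg] at h1
  have h2 := tsub_le_iff_right.2 h1
  rw [← ENNReal.ofReal_sub _ (by have := hexagonDefect_nonneg; have := Real.pi_pos; positivity)]
    at h2
  refine le_of_eq_of_le ?_ h2
  congr 1
  unfold hexagonDefect
  field_simp
  ring

theorem measurableSet_truncatedCell (r : ℝ) {Y : Set ℂ} (hY : Y.Countable) :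
    MeasurableSet (truncatedCell r Y) := by
  have h1 : MeasurableSet {z : ℂ | ‖z‖ < r} := measurableSet_lt (by fun_prop) (by fun_prop)
  have h2 : MeasurableSet (⋂ y ∈ Y, {z : ℂ | ‖z‖ < ‖z - y‖}) :=
    MeasurableSet.biInter hY fun y _ => measurableSet_lt (by fun_prop) (by fun_prop)
  convert h1.inter h2 using 1
  ext z
  simp [truncatedCell]

open MeasureTheory in
theorem Complex.volume_square (M : ℝ) :
    volume {z : ℂ | z.re ∈ Set.Icc (-M) M ∧ z.im ∈ Set.Icc (-M) M}
      = ENNReal.ofReal (2 * M) * ENNReal.ofReal (2 * M) := by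
  have h : {z : ℂ | z.re ∈ Set.Icc (-M) M ∧ z.im ∈ Set.Icc (-M) M} =
      Complex.measurableEquivRealProd ⁻¹' (Set.Icc (-M) M ×ˢ Set.Icc (-M) M) := rfl
  rw [h, Complex.volume_preserving_equiv_real_prod.measure_preimage
    (measurableSet_Icc.prod measurableSet_Icc).nullMeasurableSet, Measure.volume_eq_prod,
    Measure.prod_prod, Real.volume_Icc]
  ring_nf

/-- **Thue's theorem** on the density of circle packings, in a finite form: a bound for the number
of points of a `δ`-separated set in a square of side `2 * M`. -/
theorem card_mul_le_of_separated {δ M : ℝ} (hδ : 0 < δ) (hM : 0 ≤ M) {S : Set ℂ}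
    (hS : S.Countable) (hsep : S.Pairwise fun x y => δ ≤ ‖x - y‖) {F : Finset ℂ}
    (hF : (F : Set ℂ) ⊆ S) (hFM : ∀ x ∈ F, |x.re| ≤ M ∧ |x.im| ≤ M) :
    F.card * (√3 / 2 * δ ^ 2) ≤ (2 * (M + δ)) ^ 2 := by
  have h3 : √3 ^ 2 = 3 := Real.sq_sqrt (by norm_num)
  have h1 : 1 ≤ √3 := Real.one_le_sqrt.2 (by norm_num)
  -- The circumradius of an equilateral triangle of side `δ`.
  set r := δ / √3 with hr
  have hr0 : 0 < r := by positivity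
  have hrδ : √3 * r = δ := by
    rw [hr]
    field_simp
  have hrle : r ≤ δ := by nlinarith
  let Y : ℂ → Set ℂ := fun x => (fun y => y + -x) '' (S \ {x})
  have hYc : ∀ x, (Y x).Countable := fun x => (hS.mono Set.sdiff_subset).image _
  let T : ℂ → Set ℂ := fun x => (fun z => z + -x) ⁻¹' truncatedCell r (Y x)
  have hTm : ∀ x, MeasurableSet (T x) := fun x =>
    (measurable_add_const (-x)) (measurableSet_truncatedCell r (hYc x))
  have hTv : ∀ x ∈ S, ENNReal.ofReal (√3 / 2 * δ ^ 2) ≤ MeasureTheory.volume (T x) := by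
    intro x hx
    rw [MeasureTheory.measure_preimage_add_right]
    have h := le_volume_truncatedCell (Y := Y x) hr0 (hYc x) ?_ ?_
    · refine le_of_eq_of_le ?_ h
      congr 1
      rw [← hrδ, mul_pow, h3]
      ring
    · rintro _ ⟨y, ⟨hy, hyx⟩, rfl⟩
      simp only [hrδ, ← sub_eq_add_neg]
      exact hsep hy hx hyx
    · rintro _ ⟨y, ⟨hy, hyx⟩, rfl⟩ _ ⟨y', ⟨hy', hyx'⟩, rfl⟩ hne
      simp only [add_sub_add_right_eq_sub, hrδ]
      exact hsep hy hy' fun h => hne (by rw [h])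
  have hdisj : (F : Set ℂ).PairwiseDisjoint T := by
    intro x hx x' hx' hne
    refine Set.disjoint_left.2 fun z hz hz' => ?_
    have h4 := hz.2 (x' + -x) ⟨x', ⟨hF hx', hne.symm⟩, rfl⟩
    have h5 := hz'.2 (x + -x') ⟨x, ⟨hF hx, hne⟩, rfl⟩
    simp only [← sub_eq_add_neg, sub_sub_sub_cancel_right] at h4 h5
    exact lt_asymm h4 h5
  have hsub : (⋃ x ∈ F, T x) ⊆
      {z : ℂ | z.re ∈ Set.Icc (-(M + δ)) (M + δ) ∧ z.im ∈ Set.Icc (-(M + δ)) (M + δ)} := by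
    refine Set.iUnion₂_subset fun x hx z hz => ?_
    obtain ⟨h4, h5⟩ := hFM x hx
    have h6 := hz.1
    have h7 := (Complex.abs_re_le_norm _).trans_lt h6
    have h8 := (Complex.abs_im_le_norm _).trans_lt h6
    simp only [Complex.add_re, Complex.neg_re, Complex.add_im, Complex.neg_im, abs_lt] at h7 h8
    rw [abs_le] at h4 h5
    exact ⟨⟨by linarith, by linarith⟩, ⟨by linarith, by linarith⟩⟩
  have hmain : F.card * ENNReal.ofReal (√3 / 2 * δ ^ 2) ≤
      ENNReal.ofReal (2 * (M + δ)) * ENNReal.ofReal (2 * (M + δ)) := by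
    rw [← Complex.volume_square]
    refine le_trans ?_ (MeasureTheory.measure_mono hsub)
    rw [MeasureTheory.measure_biUnion_finset hdisj fun x _ => hTm x, ← nsmul_eq_mul]
    exact Finset.card_nsmul_le_sum _ _ _ fun x hx => hTv x (hF hx)
  rw [← ENNReal.ofReal_mul (by positivity), ← ENNReal.ofReal_natCast,
    ← ENNReal.ofReal_mul (by positivity), ENNReal.ofReal_le_ofReal_iff (by positivity)] at hmain
  rwa [sq (2 * (M + δ))]

/-! ### Hop distance against Euclidean distance. -/

theorem dist_gridPoint_sq (u v : ℤ × ℤ) : dist (gridPoint u) (gridPoint v) ^ 2 =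
    ((u.1 : ℝ) - v.1) ^ 2 + ((u.2 : ℝ) - v.2) ^ 2 := by
  rw [EuclideanSpace.dist_eq, Real.sq_sqrt (by positivity)]
  simp [gridPoint, Fin.sum_univ_two, Real.dist_eq, sq_abs]

theorem edist_gridGraph_le_one {R : ℝ} {u v : ℤ × ℤ}
    (h : dist (gridPoint u) (gridPoint v) ≤ R) : (gridGraph R).edist u v ≤ 1 := by
  rw [SimpleGraph.edist_le_one_iff_adj_or_eq]
  by_cases huv : u = v
  · exact Or.inr huv
  · exact Or.inl ⟨huv, h⟩

theorem SimpleGraph.edist_le_of_forall_edist_le_one {V : Type*} (G : SimpleGraph V) (f : ℕ → V)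
    (hf : ∀ i, G.edist (f i) (f (i + 1)) ≤ 1) (n : ℕ) : G.edist (f 0) (f n) ≤ n := by
  induction n with
  | zero => simp
  | succ n ih =>
    push_cast
    exact G.edist_triangle.trans (add_le_add ih (hf n))

theorem exists_isHopNeighbor_of_edist_le {V : Type*} {G : SimpleGraph V} {h : ℕ} {u v : V}
    (huv : G.edist u v ≤ h) : ∃ k : ℕ, k ≤ h ∧ IsHopNeighbor G k u v := by
  obtain ⟨k, hk⟩ := ENat.ne_top_iff_exists.1 (ne_top_of_le_ne_top (ENat.natCast_ne_top h) huv)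
  exact ⟨k, by rwa [← hk, Nat.cast_le] at huv, hk.symm⟩

theorem abs_round_sub_round_le (x y : ℝ) :
    |((round x : ℤ) : ℝ) - (round y : ℤ) - (x - y)| ≤ 1 := by
  have h1 := abs_sub_round x
  have h2 := abs_sub_round y
  rw [abs_le] at *
  constructor <;> linarith

theorem edist_gridGraph_le_of_dist_le {h : ℕ} (hh : 1 ≤ h) {R : ℝ} {u v : ℤ × ℤ}
    (huv : dist (gridPoint u) (gridPoint v) ≤ (R - √2) * h) : (gridGraph R).edist u v ≤ h := by
  have hpos : (0 : ℝ) < h := by exact_mod_cast hh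
  set a : ℝ := ((v.1 : ℝ) - u.1) / h with ha
  set b : ℝ := ((v.2 : ℝ) - u.2) / h with hb
  let f : ℕ → ℤ × ℤ := fun i => (round ((u.1 : ℝ) + i * a), round ((u.2 : ℝ) + i * b))
  have hf0 : f 0 = u := by simp [f]
  have hfh : f h = v := by
    have h1 : (u.1 : ℝ) + h * a = v.1 := by
      rw [ha]
      field_simp
      ring
    have h2 : (u.2 : ℝ) + h * b = v.2 := by
      rw [hb]
      field_simp
      ring
    simp only [f, h1, h2, round_intCast]
  have hR : 0 ≤ R - √2 := nonneg_of_mul_nonneg_left (dist_nonneg.trans huv) hpos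
  have hab : a ^ 2 + b ^ 2 ≤ (R - √2) ^ 2 := by
    have h1 := pow_le_pow_left₀ dist_nonneg huv 2
    rw [dist_gridPoint_sq, mul_pow] at h1
    rw [ha, hb, div_pow, div_pow, ← add_div, div_le_iff₀ (by positivity)]
    linarith
  have h2 : √2 ^ 2 = 2 := Real.sq_sqrt (by norm_num)
  have h20 := Real.sqrt_nonneg 2
  rw [← hf0, ← hfh]
  refine SimpleGraph.edist_le_of_forall_edist_le_one _ f (fun i => ?_) h
  refine edist_gridGraph_le_one (abs_le_of_sq_le_sq' ?_ (by linarith)).2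
  rw [dist_gridPoint_sq]
  have e1 := abs_round_sub_round_le ((u.1 : ℝ) + i * a) ((u.1 : ℝ) + (i + 1 : ℕ) * a)
  have e2 := abs_round_sub_round_le ((u.2 : ℝ) + i * b) ((u.2 : ℝ) + (i + 1 : ℕ) * b)
  simp only [f]
  set p := ((round ((u.1 : ℝ) + i * a) : ℤ) : ℝ) - (round ((u.1 : ℝ) + (i + 1 : ℕ) * a) : ℤ)
  set q := ((round ((u.2 : ℝ) + i * b) : ℤ) : ℝ) - (round ((u.2 : ℝ) + (i + 1 : ℕ) * b) : ℤ)
  have e3 : (u.1 : ℝ) + i * a - (u.1 + (i + 1 : ℕ) * a) = -a := by push_cast; ring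
  have e4 : (u.2 : ℝ) + i * b - (u.2 + (i + 1 : ℕ) * b) = -b := by push_cast; ring
  rw [e3, sub_neg_eq_add] at e1
  rw [e4, sub_neg_eq_add] at e2
  have f1 := sq_le_one_iff_abs_le_one _ |>.2 e1
  have f2 := sq_le_one_iff_abs_le_one _ |>.2 e2
  -- Cauchy–Schwarz for the exact step `(a, b)` and the rounding error `(p + a, q + b)`, of length
  -- at most `√2`.
  have key : |-(a * (p + a) + b * (q + b))| ≤ (R - √2) * √2 := by
    refine abs_le_of_sq_le_sq ?_ (by positivity)
    rw [mul_pow, h2]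
    have : (-(a * (p + a) + b * (q + b))) ^ 2 ≤ (a ^ 2 + b ^ 2) * ((p + a) ^ 2 + (q + b) ^ 2) := by
      nlinarith [sq_nonneg (a * (q + b) - b * (p + a))]
    refine this.trans (mul_le_mul hab (by linarith) (by positivity) (by positivity))
  have k1 := (abs_le.1 key).2
  nlinarith

/-- Unit steps along the axes are hops because `1 ≤ R`; the induction moves `v` one such step
towards `u`. -/
theorem edist_gridGraph_le_of_abs_add_abs_le {R : ℝ} (hR : 1 ≤ R) (n : ℕ) :
    ∀ u v : ℤ × ℤ, |u.1 - v.1| + |u.2 - v.2| ≤ n → (gridGraph R).edist u v ≤ n := by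
  induction n with
  | zero =>
    intro u v h
    have h1 := abs_nonneg (u.1 - v.1)
    have h2 := abs_nonneg (u.2 - v.2)
    push_cast at h
    have huv : u = v := Prod.ext (sub_eq_zero.1 (abs_eq_zero.1 (by linarith)))
      (sub_eq_zero.1 (abs_eq_zero.1 (by linarith)))
    simp [huv]
  | succ n ih =>
    intro u v h
    have step : ∀ w : ℤ × ℤ, |u.1 - w.1| + |u.2 - w.2| ≤ n →
        ((w.1 : ℝ) - v.1) ^ 2 + ((w.2 : ℝ) - v.2) ^ 2 ≤ 1 → (gridGraph R).edist u v ≤ (n + 1 : ℕ) := by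
      intro w h1 h2
      push_cast
      refine (gridGraph R).edist_triangle.trans (add_le_add (ih u w h1) (edist_gridGraph_le_one ?_))
      refine le_trans ?_ hR
      rw [← sq_le_one_iff₀ dist_nonneg, dist_gridPoint_sq]
      exact h2
    have closer : ∀ x y : ℤ, (x < y → |x - (y - 1)| = |x - y| - 1) ∧
        (y < x → |x - (y + 1)| = |x - y| - 1) := by
      refine fun x y => ⟨fun hxy => ?_, fun hxy => ?_⟩
      · rw [abs_of_nonpos (by omega), abs_of_neg (by omega)]
        ring
      · rw [abs_of_nonneg (by omega), abs_of_pos (by omega)]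
        ring
    push_cast at h
    rcases lt_trichotomy u.1 v.1 with h1 | h1 | h1
    · exact step (v.1 - 1, v.2) (by linarith [(closer u.1 v.1).1 h1]) (by push_cast; norm_num)
    · rcases lt_trichotomy u.2 v.2 with h2 | h2 | h2
      · exact step (v.1, v.2 - 1) (by linarith [(closer u.2 v.2).1 h2]) (by push_cast; norm_num)
      · exact step v (by simp [h1, h2]) (by norm_num)
      · exact step (v.1, v.2 + 1) (by linarith [(closer u.2 v.2).2 h2]) (by push_cast; norm_num)
    · exact step (v.1 + 1, v.2) (by linarith [(closer u.1 v.1).2 h1]) (by push_cast; norm_num)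

/-- For `1 ≤ R ≤ √2` one has `|R - √2| ≤ 1 / 2`, so the `ℓ¹` distance is at most `√2 * h / 2 ≤ h`
and an axis-parallel path suffices. -/
theorem edist_gridGraph_le_of_dist_le_abs {h : ℕ} (hh : 1 ≤ h) {R : ℝ} (hR : 1 ≤ R) {u v : ℤ × ℤ}
    (huv : dist (gridPoint u) (gridPoint v) ≤ |R - √2| * h) : (gridGraph R).edist u v ≤ h := by
  rcases le_total 0 (R - √2) with h0 | h0
  · rw [abs_of_nonneg h0] at huv
    exact edist_gridGraph_le_of_dist_le hh huv
  · rw [abs_of_nonpos h0] at huv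
    refine edist_gridGraph_le_of_abs_add_abs_le hR h u v ?_
    have h2 : √2 ^ 2 = 2 := Real.sq_sqrt (by norm_num)
    have h3 : √2 ≤ 3 / 2 := Real.sqrt_le_iff.2 (by norm_num)
    have hle : dist (gridPoint u) (gridPoint v) ≤ 1 / 2 * h :=
      huv.trans (mul_le_mul_of_nonneg_right (by linarith) (Nat.cast_nonneg h))
    have h4 := pow_le_pow_left₀ dist_nonneg hle 2
    rw [dist_gridPoint_sq] at h4
    have h5 : |((u.1 : ℝ) - v.1)| + |((u.2 : ℝ) - v.2)| ≤ h := by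
      refine (abs_le_of_sq_le_sq' ?_ (Nat.cast_nonneg h)).2
      nlinarith [sq_abs ((u.1 : ℝ) - v.1), sq_abs ((u.2 : ℝ) - v.2),
        sq_nonneg (|((u.1 : ℝ) - v.1)| - |((u.2 : ℝ) - v.2)|)]
    exact_mod_cast h5

theorem IsHopColoring.lt_edist {V C : Type*} {G : SimpleGraph V} {h : ℕ} {c : V → C}
    (hc : IsHopColoring G h c) {u v : V} (huv : u ≠ v) (hcuv : c u = c v) : h < G.edist u v := by
  by_contra! hle
  obtain ⟨k, hk, hn⟩ := exists_isHopNeighbor_of_edist_le hle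
  refine hc k (Nat.one_le_iff_ne_zero.2 ?_) hk u v hn hcuv
  rintro rfl
  exact huv (G.edist_eq_zero_iff.1 hn)

/-! ### Density of a colour class and number of colours. -/

/-- The grid node `p` as a Gaussian integer in the complex plane. -/
def gridComplex (p : ℤ × ℤ) : ℂ := ⟨p.1, p.2⟩

theorem gridComplex_injective : Function.Injective gridComplex := by
  intro p q h
  have h1 := congrArg Complex.re h
  have h2 := congrArg Complex.im h
  simp only [gridComplex, Int.cast_inj] at h1 h2
  exact Prod.ext h1 h2

theorem norm_gridComplex_sub (u v : ℤ × ℤ) :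
    ‖gridComplex u - gridComplex v‖ = dist (gridPoint u) (gridPoint v) := by
  rw [← sq_eq_sq₀ (norm_nonneg _) dist_nonneg, dist_gridPoint_sq, ← Complex.normSq_eq_norm_sq,
    Complex.normSq_apply]
  simp [gridComplex, sq]

theorem finite_gridBox (n : ℕ) : (gridBox n).Finite :=
  (Set.finite_Icc _ _).prod (Set.finite_Icc _ _)

theorem ncard_gridBox (n : ℕ) : ((gridBox n).ncard : ℝ) = (2 * (n : ℝ) + 1) ^ 2 := by
  rw [gridBox, Set.ncard_prod, ← Finset.coe_Icc, Set.ncard_coe_finset, Int.card_Icc]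
  have : ((n : ℤ) + 1 - -(n : ℤ)).toNat = 2 * n + 1 := by omega
  rw [this]
  push_cast
  ring

theorem ncard_inter_gridBox_mul_le {δ : ℝ} (hδ : 0 < δ) {S : Set (ℤ × ℤ)}
    (hS : S.Pairwise fun u v => δ ≤ dist (gridPoint u) (gridPoint v)) (n : ℕ) :
    ((S ∩ gridBox n).ncard : ℝ) * (√3 / 2 * δ ^ 2) ≤ (2 * (n + δ)) ^ 2 := by
  have hfin : (S ∩ gridBox n).Finite := (finite_gridBox n).inter_of_right S
  classical
  have hcard : (S ∩ gridBox n).ncard = (hfin.toFinset.image gridComplex).card := by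
    rw [Finset.card_image_of_injective _ gridComplex_injective, Set.ncard_eq_toFinset_card _ hfin]
  rw [hcard]
  refine card_mul_le_of_separated hδ (Nat.cast_nonneg n) (S := gridComplex '' S)
    (S.to_countable.image _) ?_ ?_ ?_
  · rintro _ ⟨u, hu, rfl⟩ _ ⟨v, hv, rfl⟩ hne
    simp only [norm_gridComplex_sub]
    exact hS hu hv fun h => hne (by rw [h])
  · intro x hx
    simp only [Finset.coe_image, Set.Finite.coe_toFinset] at hx
    exact Set.image_mono Set.inter_subset_left hx
  · intro x hx
    simp only [Finset.mem_image, Set.Finite.mem_toFinset] at hx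
    obtain ⟨u, ⟨-, ⟨h1, h2⟩, h3, h4⟩, rfl⟩ := hx
    simp only [gridComplex, abs_le]
    exact ⟨⟨by exact_mod_cast h1, by exact_mod_cast h2⟩,
      ⟨by exact_mod_cast h3, by exact_mod_cast h4⟩⟩

theorem tendsto_enlarged_box_ratio (δ : ℝ) : Filter.Tendsto
    (fun n : ℕ => (2 * ((n : ℝ) + δ)) ^ 2 / (2 * (n : ℝ) + 1) ^ 2) Filter.atTop (nhds 1) := by
  have h1 : Filter.Tendsto (fun n : ℕ => 2 * (n : ℝ) + 1) Filter.atTop Filter.atTop :=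
    Filter.tendsto_atTop_add_const_right _ _
      (tendsto_natCast_atTop_atTop.const_mul_atTop (by norm_num))
  have h2 : Filter.Tendsto (fun n : ℕ => (1 + (2 * δ - 1) / (2 * (n : ℝ) + 1)) ^ 2) Filter.atTop
      (nhds ((1 + 0) ^ 2)) := ((h1.const_div_atTop (2 * δ - 1)).const_add 1).pow 2
  rw [add_zero, one_pow] at h2
  refine h2.congr fun n => ?_
  have : 2 * (n : ℝ) + 1 ≠ 0 := by positivity
  rw [← div_pow]
  congr 1
  field_simp
  ring

theorem gridUpperDensity_mul_le_one {δ : ℝ} (hδ : 0 ≤ δ) {S : Set (ℤ × ℤ)}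
    (hS : S.Pairwise fun u v => δ ≤ dist (gridPoint u) (gridPoint v)) :
    gridUpperDensity S * (√3 / 2 * δ ^ 2) ≤ 1 := by
  rcases hδ.eq_or_lt with rfl | hδ
  · simp
  have hc : 0 < √3 / 2 * δ ^ 2 := by positivity
  rw [← le_div_iff₀ hc]
  have ht := (tendsto_enlarged_box_ratio δ).div_const (√3 / 2 * δ ^ 2)
  rw [← ht.limsup_eq]
  refine Filter.limsup_le_limsup (Filter.Eventually.of_forall fun n => ?_) ?_ ht.isBoundedUnder_le
  · have h := ncard_inter_gridBox_mul_le hδ hS n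
    simp only
    rw [le_div_iff₀ hc, div_mul_eq_mul_div]
    gcongr
  -- Comparing real `limsup`s needs the proportions bounded below, here by `0`.
  · refine Filter.IsBoundedUnder.isCoboundedUnder_le ⟨0, ?_⟩
    rw [Filter.eventually_map]
    exact Filter.Eventually.of_forall fun n => by positivity

/-- The colour classes partition each box, so Thue's bound can be summed over the colours before
letting `n` tend to infinity. -/
theorem le_ncard_range_of_separated {C : Type*} {c : ℤ × ℤ → C} (hfin : (Set.range c).Finite)
    {δ : ℝ} (hδ : 0 ≤ δ) (hc : ∀ a, (c ⁻¹' {a}).Pairwise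
      fun u v => δ ≤ dist (gridPoint u) (gridPoint v)) :
    √3 / 2 * δ ^ 2 ≤ (Set.range c).ncard := by
  rcases hδ.eq_or_lt with rfl | hδ
  · simp
  classical
  have hn : ∀ n : ℕ, √3 / 2 * δ ^ 2 ≤
      (Set.range c).ncard * ((2 * ((n : ℝ) + δ)) ^ 2 / (2 * (n : ℝ) + 1) ^ 2) := by
    intro n
    have hsum : (gridBox n).ncard = ∑ a ∈ hfin.toFinset, (c ⁻¹' {a} ∩ gridBox n).ncard := by
      rw [Set.ncard_eq_toFinset_card _ (finite_gridBox n),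
        Finset.card_eq_sum_card_fiberwise (f := c) (t := hfin.toFinset) fun u _ => by simp]
      refine Finset.sum_congr rfl fun a _ => ?_
      rw [← Set.ncard_coe_finset]
      congr 1
      ext u
      simp [and_comm]
    have h1 : (2 * (n : ℝ) + 1) ^ 2 * (√3 / 2 * δ ^ 2) ≤
        (Set.range c).ncard * (2 * ((n : ℝ) + δ)) ^ 2 := by
      rw [← ncard_gridBox, hsum, Nat.cast_sum, Finset.sum_mul,
        Set.ncard_eq_toFinset_card _ hfin, ← nsmul_eq_mul]
      exact Finset.sum_le_card_nsmul _ _ _ fun a _ => ncard_inter_gridBox_mul_le hδ (hc a) n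
    rw [← mul_div_assoc, le_div_iff₀ (by positivity), mul_comm]
    exact h1
  have ht := (tendsto_enlarged_box_ratio δ).const_mul ((Set.range c).ncard : ℝ)
  rw [mul_one] at ht
  exact ge_of_tendsto' ht hn

theorem mainTheorem6 (h : ℕ) (hh : 1 ≤ h) (R : ℝ) (hR : 1 ≤ R) :
    (∀ u v : ℤ × ℤ, dist (gridPoint u) (gridPoint v) ≤ (R - √2) * h →
      ∃ k : ℕ, k ≤ h ∧ IsHopNeighbor (gridGraph R) k u v) ∧
    ∀ {C : Type*} (c : ℤ × ℤ → C), IsHopColoring (gridGraph R) h c →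
      (∀ a : C, (c ⁻¹' {a}).PairwiseDisjoint
        (fun u => Metric.closedBall (gridPoint u) ((R - √2) * h / 2))) ∧
      (∀ a : C, gridUpperDensity (c ⁻¹' {a}) *
        (√3 / 2 * (h : ℝ) ^ 2 * (R - √2) ^ 2) ≤ 1) ∧
      ENNReal.ofReal (√3 / 2 * (h : ℝ) ^ 2 * (R - √2) ^ 2) ≤
        ((Set.range c).encard : ENNReal) := by
  refine ⟨fun u v huv => exists_isHopNeighbor_of_edist_le (edist_gridGraph_le_of_dist_le hh huv),
    fun {C} c hc => ?_⟩
  have hsep : ∀ a : C, (c ⁻¹' {a}).Pairwise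
      fun u v => |R - √2| * h ≤ dist (gridPoint u) (gridPoint v) := by
    intro a u hu v hv hne
    by_contra! hlt
    exact (edist_gridGraph_le_of_dist_le_abs hh hR hlt.le).not_gt
      (hc.lt_edist hne (hu.trans hv.symm))
  have hδ : 0 ≤ |R - √2| * h := by positivity
  have hval : √3 / 2 * (h : ℝ) ^ 2 * (R - √2) ^ 2 = √3 / 2 * (|R - √2| * h) ^ 2 := by
    rw [mul_pow, sq_abs]
    ring
  rw [hval]
  refine ⟨fun a u hu v hv hne => Set.disjoint_left.2 fun x hx hx' => ?_,
    fun a => gridUpperDensity_mul_le_one hδ (hsep a), ?_⟩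
  · rw [Metric.mem_closedBall] at hx hx'
    refine (edist_gridGraph_le_of_dist_le hh ?_).not_gt (hc.lt_edist hne (hu.trans hv.symm))
    linarith [dist_triangle_left (gridPoint u) (gridPoint v) x]
  · by_cases hfin : (Set.range c).Finite
    · rw [← hfin.cast_ncard_eq, ENat.toENNReal_coe, ← ENNReal.ofReal_natCast]
      exact ENNReal.ofReal_le_ofReal (le_ncard_range_of_separated hfin hδ hsep)
    · rw [Set.Infinite.encard_eq hfin, ENat.toENNReal_top]
      exact le_top
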